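/- Let $q$ be a prime power, let $m>1$ be a divisor of $n$, and let $k\ge 1$ be an integer with $\gcd(k,n)=1$. Regard $\mathbb F_{q^m}$ as the subfield of order $q^m$ of $\mathbb F_{q^n}$, and let $\Omega$ be the $\mathbb F_q$-vector space of all $\mathbb F_q$-bilinear forms $f:\mathbb F_{q^m}\times\mathbb F_{q^n}\to\mathbb F_q$. The rank of $f\in\Omega$ is the codimension in $\mathbb F_{q^m}$ of its left radical $\{x : f(x,x')=0 \text{ for all } x'\in\mathbb F_{q^n}\}$. Two subsets of $\Omega$ are called equivalent if one is mapped onto the other by a bijective semilinear (with respect to some automorphism of $\mathbb F_q$) map $\Omega\to\Omega$ that preserves the rank. For $a\in\mathbb F_{q^n}$ and $j\ge 0$ put $f_{a,j}(x,x')=\mathrm{Tr}_{q^n/q}\bigl(a\,x\,x'^{\,q^{kj}}\bigr)$. For $t\ge 1$, $\mu\in\mathbb F_{q^n}$ and $s\in\mathbb Z$, the generalized twisted Gabidulin code is the set of bilinear forms on $\mathbb F_{q^n}\times\mathbb F_{q^n}$ $$\mathcal H^{(k)}_{n,n,t,\mu,s}=\Bigl\{f_{a,0}+\sum_{j=1}^{t-1}f_{c_j,j}+f_{\mu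 a^{q^{sk}},t}\;:\;a,c_1,\dots,c_{t-1}\in\mathbb F_{q^n}\Bigr\}$$ (exponents of $q$ are read modulo $n$), and the punctured code $\mathcal H^{(k)}_{m,n,t,\mu,s}\subseteq\Omega$ is the set of the restrictions of its members to $\mathbb F_{q^m}\times\mathbb F_{q^n}$. A subset of $\Omega$ is called a generalized Gabidulin code if there are integers $j\ge1$ with $\gcd(j,n)=1$ and $1\le \tau\le n$, elements $g_0,\dots,g_{m-1}\in\mathbb F_{q^n}$ linearly independent over $\mathbb F_q$, an $\mathbb F_q$-basis $u$ of $\mathbb F_{q^n}$, and $\mathbb F_q$-bases of $\mathbb F_{q^m}$ and $\mathbb F_{q^n}$ in which the matrices of its members are exactly the $m\times n$ matrices whose $i$-th row ($0\le i\le m-1$) is the coordinate vector, in the basis $u$, of $P(g_i)$, where $P$ runs over all polynomials $P(x)=\sum_{h=0}^{\tau-1}a_h x^{q^{jh}}$ with $a_h\in\mathbb F_{q^n}$. **Theorem.** Let $t\in\{1,\dots,m-2\}$, let $\mu\in\mathbb F_{q^n}$ with $\mu\ne0$ and $\mathrm N_{q^n/q}(\mu)\neq(-1)^{nt}$, and let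 $s$ be an integer with $s\not\equiv 0,\pm1,\pm2\pmod m$ and $\gcd(n,sk-t)<m$. Then the punctured code $\mathcal H^{(k)}_{m,n,t,\mu,s}$ is not equivalent to any generalized Gabidulin code. -/

import Mathlib

namespace RankMetric

/-! ### The rank metric space of bilinear forms and equivalence of codes -/

section Forms

variable {F V V' : Type*} [Field F] [AddCommGroup V] [Module F V] [AddCommGroup V'] [Module F V']

/-- The rank of a bilinear form on `V × V'`: the codimension in `V` of its left radical
`{v | ∀ v', f v v' = 0}`, which is the kernel of `f : V → Hom(V', F)`. -/
noncomputable def formRank (f : V →ₗ[F] V' →ₗ[F] F) : ℕ :=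
  Module.finrank F V - Module.finrank F (LinearMap.ker f)

/-- Two sets of bilinear forms on `V × V'` are equivalent if some automorphism of the rank metric
space, i.e. an invertible semilinear transformation `φ` (with companion automorphism `σ` of `F`)
of the space of all bilinear forms that preserves the rank, maps the first onto the second. -/
def CodeEquivalent (X₁ X₂ : Set (V →ₗ[F] V' →ₗ[F] F)) : Prop :=
  ∃ (σ : F ≃+* F) (φ : (V →ₗ[F] V' →ₗ[F] F) ≃+ (V →ₗ[F] V' →ₗ[F] F)),
    (∀ (c : F) (f : V →ₗ[F] V' →ₗ[F] F), φ (c • f) = σ c • φ f) ∧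
    (∀ f : V →ₗ[F] V' →ₗ[F] F, formRank (φ f) = formRank f) ∧
    φ '' X₁ = X₂

end Forms

section Codes

variable (F : Type*) {L : Type*} [Field F] [Fintype F] [Field L] [Algebra F L]

/-! ### Generalized Gabidulin codes -/

/-- The matrices attached to `g = (g_0, …, g_{m-1})`: for each `q^k`-polynomial
`f = a_0 x + a_1 x^{q^k} + ⋯ + a_{t-1} x^{q^{k(t-1)}}` over `L` the `m × n` matrix whose `i`-th row
consists of the coordinates of `f(g_i)` in the basis `u` of `L` over `F`. -/
def gabidulinMatrices {m n : ℕ} (u : Module.Basis (Fin n) F L) (g : Fin m → L) (t k : ℕ) :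
    Set (Matrix (Fin m) (Fin n) F) :=
  {M | ∃ a : Fin t → L, ∀ (i : Fin m) (l : Fin n),
    M i l = u.repr (∑ h : Fin t, a h * g i ^ (Fintype.card F ^ (k * (h : ℕ)))) l}

/-- A set of bilinear forms on `V × V'` is a generalized Gabidulin code (over the field extension
`L` of `F`, of degree `dim V'`) if in some bases of `V` and `V'` the matrices of its members form
a code `gabidulinMatrices F u g t k` with `1 ≤ t ≤ n`, `1 ≤ k`, `gcd(k, n) = 1` and
`g_0, …, g_{m-1}` linearly independent over `F`. -/
def IsGeneralizedGabidulin (L : Type*) [Field L] [Algebra F L]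
    {V V' : Type*} [AddCommGroup V] [Module F V] [AddCommGroup V'] [Module F V']
    (C : Set (V →ₗ[F] V' →ₗ[F] F)) : Prop :=
  ∃ (m n : ℕ) (b : Module.Basis (Fin m) F V) (b' : Module.Basis (Fin n) F V')
    (u : Module.Basis (Fin n) F L) (g : Fin m → L) (t k : ℕ),
    LinearIndependent F g ∧ 1 ≤ t ∧ t ≤ n ∧ 1 ≤ k ∧ Nat.Coprime k n ∧
    C = {f | LinearMap.toMatrix₂ b b' f ∈ gabidulinMatrices F u g t k}

/-! ### Generalized twisted Gabidulin codes and their puncturing -/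

/-- The bilinear form `f_{a,j}^{(k)}(x, x') = Tr_{L/F}(a x x'^{q^{kj}})` on `L × L`, where `L` is
identified with its `k`-cyclic model through `x ↦ (x, x^{q^k}, …, x^{q^{k(n-1)}})`. -/
noncomputable def traceForm (k : ℕ) (a : L) (j : ℕ) : L →ₗ[F] L →ₗ[F] F :=
  LinearMap.mk₂ F (fun x x' => Algebra.trace F L (a * x * x' ^ (Fintype.card F ^ (k * j))))
    (fun x₁ x₂ y => by rw [← map_add]; congr 1; ring)
    (fun c x y => by
      rw [← map_smul]; congr 1; simp only [Algebra.smul_def]; ring)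
    (fun x y₁ y₂ => by
      have h := map_add (FiniteField.frobeniusAlgHom F L ^ (k * j)) y₁ y₂
      simp only [AlgHom.coe_pow, FiniteField.coe_frobeniusAlgHom, pow_iterate] at h
      rw [h, mul_add, map_add])
    (fun c x y => by
      have h := map_smul (FiniteField.frobeniusAlgHom F L ^ (k * j)) c y
      simp only [AlgHom.coe_pow, FiniteField.coe_frobeniusAlgHom, pow_iterate] at h
      rw [h, mul_smul_comm, map_smul])

variable [FiniteDimensional F L]

/-- The generalized twisted Gabidulin code `H_{n,n,t,μ,s}^{(k)} = Γ ⊕ Ω_1 ⊕ ⋯ ⊕ Ω_{t-1}` in the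
bilinear forms on `L × L`, with `Γ = {f_{a,0} + f_{μ a^{q^{sk}}, t} : a ∈ L}` and
`Ω_j = {f_{c,j} : c ∈ L}`. Since `s` is any integer, `a ↦ a^{q^{sk}}` is written as the power `sk`
of the automorphism `a ↦ a^q` of `L`. -/
def twistedGabidulin (t : ℕ) (μ : L) (s : ℤ) (k : ℕ) : Set (L →ₗ[F] L →ₗ[F] F) :=
  {f | ∃ (a : L) (c : ℕ → L),
    f = traceForm F k a 0
      + traceForm F k
          (μ * (FiniteField.frobeniusAlgEquivOfAlgebraic F L ^ (s * (k : ℤ))) a) t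
      + ∑ j ∈ Finset.Ico 1 t, traceForm F k (c j) j}

/-- The punctured code `H_{m,n,t,μ,s}^{(k)}`: the restrictions to `K × L` of the members of
`H_{n,n,t,μ,s}^{(k)}`, where `K` is the subfield of `L` with `q^m` elements. In the cyclic models,
`x ∈ K` has the coordinates `(x, x^{q^k}, …, x^{q^{k(n-1)}})`, which consist of `n / m` copies of
`(x, x^{q^k}, …, x^{q^{k(m-1)}})`, so this is the puncturing with `(I_m | I_m | ⋯ | I_m)`. -/
def puncturedTwistedGabidulin (K : IntermediateField F L) (t : ℕ) (μ : L) (s : ℤ) (k : ℕ) :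
    Set (K →ₗ[F] L →ₗ[F] F) :=
  (fun f : L →ₗ[F] L →ₗ[F] F => f ∘ₗ K.val.toLinearMap) '' twistedGabidulin F t μ s k

end Codes

end RankMetric

/-!
Through the trace form a code becomes a set of maps `K → L`. A rank-preserving semilinear
transformation has the form `f ↦ p ∘ f ∘ B`, possibly up to transposition, so a code equivalent to
a generalized Gabidulin code is a set of maps `A ∘ P ∘ γ`, where `P` runs over the linearized
polynomials with a fixed number of terms in a generator `φ` of `Gal(L/F)`.

A map `K → L` is a unique combination `∑ v(g) g` of the automorphisms of `K`, and for the punctured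
code `v` is supported on `1, τ, …, τ^t` with `v(τ^t) = N(v(1))`. Comparing coefficients shows that
a linear map of `L` stabilizing this code is `K`-linear. The set of all `A ∘ P ∘ γ` is stable under
`A ∘ (multiplication by l) ∘ A⁻¹`, so these maps are `K`-linear and contain the multiplications
by `K`. This forces `N` to be `K`-linear and `A ∘ φ ∘ A⁻¹` to be semilinear over `K` with respect
to the nontrivial automorphism `d = φ|_K`.

Splitting off the lowest term, every member of the code is a map `A(l γ(x))` plus a member `w` that
is also `A ∘ φ ∘ A⁻¹ ∘ u` for a member `u`. The coefficients of `w` are those of `u` shifted by `d`,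
so `w` vanishes at two fixed positions below `t`. There the coefficients of the given member are
arbitrary but determined by `l`, so that `|L|² ≤ |L|`, which is absurd.
-/

namespace RankMetric

open Module LinearMap

/-! ### Rank-one maps and rank-preserving transformations -/

section RankOne

variable {F V W : Type*} [Field F] [AddCommGroup V] [Module F V] [AddCommGroup W] [Module F W]

theorem eq_smulRight_of_range_le {T : V →ₗ[F] W} {w : W} {η : Dual F W} (hη : η w = 1)
    (h : range T ≤ F ∙ w) : T = (η ∘ₗ T).smulRight w := by
  ext x
  obtain ⟨c, hc⟩ := Submodule.mem_span_singleton.1 (h (mem_range_self T x))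
  simp [← hc, hη]

theorem eq_smulRight_of_ker_le {T : V →ₗ[F] W} {ξ : Dual F V} {v : V} (hv : ξ v = 1)
    (h : ker ξ ≤ ker T) : T = ξ.smulRight (T v) := by
  ext x
  have hx : T (x - ξ x • v) = 0 := h (by simp [hv])
  simpa [sub_eq_zero] using hx

theorem range_smulRight_le (ξ : Dual F V) (w : W) : range (ξ.smulRight w) ≤ F ∙ w := by
  rintro _ ⟨x, rfl⟩
  exact Submodule.mem_span_singleton.2 ⟨ξ x, rfl⟩

theorem rank_smulRight_le_one (ξ : Dual F V) (w : W) : (ξ.smulRight w).rank ≤ 1 :=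
  (rank_submodule_le_one_iff' _).2 ⟨w, range_smulRight_le ξ w⟩

theorem range_eq_span_of_rank_le_one {T : V →ₗ[F] W} {w : W} (hT : T.rank ≤ 1)
    (hw : w ∈ range T) (hw0 : w ≠ 0) : range T = F ∙ w := by
  obtain ⟨w', hw'⟩ := (rank_submodule_le_one_iff' _).1 hT
  obtain ⟨c, rfl⟩ := Submodule.mem_span_singleton.1 (hw' hw)
  refine le_antisymm (hw'.trans_eq ?_) ((Submodule.span_singleton_le_iff_mem _ _).2 hw)
  exact (Submodule.span_singleton_smul_eq (left_ne_zero_of_smul hw0).isUnit w').symm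

theorem exists_eq_smulRight_of_rank_le_one {T : V →ₗ[F] W} (hT : T.rank ≤ 1) (hT0 : T ≠ 0) :
    ∃ (ξ : Dual F V) (w : W), w ≠ 0 ∧ T = ξ.smulRight w := by
  obtain ⟨x, hx⟩ := DFunLike.ne_iff.1 hT0
  obtain ⟨η, hη⟩ := Projective.exists_dual_eq_one F hx
  exact ⟨η ∘ₗ T, T x, hx, eq_smulRight_of_range_le hη
    (range_eq_span_of_rank_le_one hT (mem_range_self T x) hx).le⟩

theorem ker_le_or_range_le_of_rank_add_le_one {T₀ T : V →ₗ[F] W} (hT₀ : T₀ ≠ 0)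
    (hT : T.rank ≤ 1) (hadd : (T₀ + T).rank ≤ 1) : ker T₀ ≤ ker T ∨ range T ≤ range T₀ := by
  rw [or_iff_not_imp_left, SetLike.not_le_iff_exists]
  rintro ⟨x, hx₀, hx⟩
  have hrange : range T = F ∙ T x := range_eq_span_of_rank_le_one hT (mem_range_self T x) hx
  have hrange_add : range (T₀ + T) = F ∙ T x :=
    range_eq_span_of_rank_le_one hadd ⟨x, by simp [mem_ker.1 hx₀]⟩ hx
  obtain ⟨z, hz⟩ := DFunLike.ne_iff.1 hT₀
  have hTz : T₀ z ∈ range T := by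
    rw [← add_sub_cancel_right (T₀ z) (T z), hrange]
    exact sub_mem (hrange_add ▸ mem_range_self (T₀ + T) z) (hrange ▸ mem_range_self T z)
  rw [range_eq_span_of_rank_le_one hT hTz hz, Submodule.span_singleton_le_iff_mem]
  exact mem_range_self T₀ z

end RankOne

section CommonFactor

variable {F X V W : Type*} [Field F] [AddCommGroup X] [Module F X] [AddCommGroup V] [Module F V]
  [AddCommGroup W] [Module F W] {σ : F →+* F} {S : X →ₛₗ[σ] V →ₗ[F] W}

theorem forall_ker_le_or_forall_range_le (hS : ∀ x, (S x).rank ≤ 1) {x₀ : X} (hx₀ : S x₀ ≠ 0) :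
    (∀ x, ker (S x₀) ≤ ker (S x)) ∨ ∀ x, range (S x) ≤ range (S x₀) := by
  have hor (x : X) : ker (S x₀) ≤ ker (S x) ∨ range (S x) ≤ range (S x₀) :=
    ker_le_or_range_le_of_rank_add_le_one hx₀ (hS x) (map_add S x₀ x ▸ hS (x₀ + x))
  by_contra! ⟨⟨x, hx⟩, ⟨y, hy⟩⟩
  have hxr := (hor x).resolve_left hx
  have hyk := (hor y).resolve_right hy
  rcases hor (x + y) with h | h
  · refine hx fun v hv => ?_
    simpa [mem_ker.1 (hyk hv)] using h hv
  · refine hy ?_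
    rintro _ ⟨v, rfl⟩
    exact (Submodule.add_mem_iff_right _ (hxr ⟨v, rfl⟩)).1 (by simpa using h ⟨v, rfl⟩)

theorem exists_common_factor (hS : ∀ x, (S x).rank ≤ 1) (hS0 : S ≠ 0) :
    (∃ ξ : Dual F V, ξ ≠ 0 ∧ ∃ p : X →ₛₗ[σ] W, ∀ x, S x = ξ.smulRight (p x)) ∨
      ∃ w : W, w ≠ 0 ∧ ∃ p : X →ₛₗ[σ] Dual F V, ∀ x, S x = (p x).smulRight w := by
  obtain ⟨x₀, hx₀⟩ := DFunLike.ne_iff.1 hS0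
  obtain ⟨ξ, w, hw, hξw⟩ := exists_eq_smulRight_of_rank_le_one (hS x₀) hx₀
  have hξ : ξ ≠ 0 := by rintro rfl; simp_all
  obtain ⟨v, hv⟩ : ∃ v, ξ v = 1 := LinearMap.surjective hξ 1
  obtain ⟨η, hη⟩ := Projective.exists_dual_eq_one F hw
  refine (forall_ker_le_or_forall_range_le hS hx₀).imp
    (fun h => ⟨ξ, hξ, S.flip v, fun x => ?_⟩) fun h => ⟨w, hw, compRight F η ∘ₛₗ S, fun x => ?_⟩
  · refine eq_smulRight_of_ker_le hv (le_trans (fun u hu => ?_) (h x))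
    simp_all
  · refine eq_smulRight_of_range_le hη ((h x).trans ?_)
    exact hξw ▸ range_smulRight_le ξ w

end CommonFactor

section Factorization

variable {F V W V₂ W₂ : Type*} [Field F] [AddCommGroup V] [Module F V]
  [AddCommGroup W] [Module F W] [AddCommGroup V₂] [Module F V₂] [AddCommGroup W₂] [Module F W₂]
  {σ σ' : F →+* F} [RingHomInvPair σ σ'] [RingHomInvPair σ' σ]
  {ψ : (V →ₗ[F] W) →ₛₗ[σ] V₂ →ₗ[F] W₂} {p : W ≃ₛₗ[σ] W₂} {ξ₁ : Dual F V} {η₁ : Dual F V₂}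

theorem range_map_smulRight_le (hψ : Function.Injective ψ)
    (hrank : ∀ T, T.rank ≤ 1 → (ψ T).rank ≤ 1) (hη₁ : η₁ ≠ 0)
    (hp : ∀ w, ψ (ξ₁.smulRight w) = η₁.smulRight (p w)) (ξ : Dual F V) (w : W) :
    range (ψ (ξ.smulRight w)) ≤ F ∙ p w := by
  rcases eq_or_ne w 0 with rfl | hw
  · simp
  obtain ⟨v, hv⟩ : ∃ v, η₁ v = 1 := LinearMap.surjective hη₁ 1
  have hne : η₁.smulRight (p w) ≠ 0 := fun h => hw (by simpa [hv] using congr($h v))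
  have hadd : (η₁.smulRight (p w) + ψ (ξ.smulRight w)).rank ≤ 1 := by
    rw [← hp, ← map_add, show ξ₁.smulRight w + ξ.smulRight w = (ξ₁ + ξ).smulRight w by
      ext; simp [add_smul]]
    exact hrank _ (rank_smulRight_le_one _ _)
  rcases ker_le_or_range_le_of_rank_add_le_one hne (hrank _ (rank_smulRight_le_one ξ w)) hadd
    with hker | hrange
  · obtain ⟨u, hu⟩ : ∃ u, ψ (ξ.smulRight w) = η₁.smulRight (p u) :=
      ⟨p.symm (ψ (ξ.smulRight w) v), by
        rw [p.apply_symm_apply]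
        exact eq_smulRight_of_ker_le hv (le_trans (fun y hy => by simp_all) hker)⟩
    have hξ₁ : ξ₁ ≠ 0 := by
      rintro rfl
      exact hne (by rw [← hp, ← map_zero ψ]; congr 1; ext; simp)
    obtain ⟨x, hx⟩ : ∃ x, ξ₁ x = 1 := LinearMap.surjective hξ₁ 1
    have hwu : ξ x • w = u := by
      simpa [hx] using congr($(hψ (hu.trans (hp u).symm)) x)
    rw [hu, ← hwu, map_smulₛₗ]
    exact (range_smulRight_le _ _).trans (Submodule.span_singleton_smul_le _ _ _)
  · exact hrange.trans (range_smulRight_le _ _)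

theorem exists_map_smulRight_apply_eq (hψ : Function.Injective ψ)
    (hrank : ∀ T, T.rank ≤ 1 → (ψ T).rank ≤ 1) (hη₁ : η₁ ≠ 0)
    (hp : ∀ w, ψ (ξ₁.smulRight w) = η₁.smulRight (p w)) (ξ : Dual F V) (y : V₂) :
    ∃ c : F, ∀ w, ψ (ξ.smulRight w) y = p (c • w) := by
  let f : W →ₗ[F] W :=
    p.symm.toLinearMap ∘ₛₗ (ψ ∘ₛₗ smulRightₗ ξ : W →ₛₗ[σ] V₂ →ₗ[F] W₂).flip y
  have hf (w : W) : f w = p.symm (ψ (ξ.smulRight w) y) := rfl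
  obtain ⟨c, hc⟩ := exists_eq_smul_id_of_forall_notLinearIndependent (f := f) fun w => by
    obtain ⟨c, hc⟩ := Submodule.mem_span_singleton.1
      (range_map_smulRight_le hψ hrank hη₁ hp ξ w (mem_range_self _ y))
    rw [LinearIndependent.pair_iff]
    intro h
    simpa using (h (σ' c) (-1) (by simp [hf, ← hc, map_smulₛₗ])).2
  exact ⟨c, fun w => by simpa [hf, p.symm_apply_eq] using congr($hc w)⟩

theorem exists_eq_comp [Nontrivial W] [FiniteDimensional F V] (hψ : Function.Injective ψ)
    (hrank : ∀ T, T.rank ≤ 1 → (ψ T).rank ≤ 1) (hη₁ : η₁ ≠ 0)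
    (hp : ∀ w, ψ (ξ₁.smulRight w) = η₁.smulRight (p w)) :
    ∃ B : V₂ →ₛₗ[σ'] V, ∀ T y, ψ T y = p (T (B y)) := by
  obtain ⟨w, hw⟩ := exists_ne (0 : W)
  obtain ⟨η, hη⟩ := Projective.exists_dual_eq_one F hw
  choose c hc using exists_map_smulRight_apply_eq hψ hrank hη₁ hp
  let g : Dual F V →ₛₗ[σ] V₂ →ₗ[F] W₂ := ψ ∘ₛₗ smulRightₗ.flip w
  let q : W₂ →ₛₗ[σ'] F := η ∘ₛₗ p.symm.toLinearMap
  let β : V₂ →ₛₗ[σ'] Dual F (Dual F V) := mk₂'ₛₗ σ' (RingHom.id F) (fun y ξ => q (g ξ y))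
    (by simp) (by simp [map_smulₛₗ]) (by simp) (by simp [map_smulₛₗ])
  let B : V₂ →ₛₗ[σ'] V := (evalEquiv F V).symm.toLinearMap ∘ₛₗ β
  have hB (ξ : Dual F V) (y : V₂) : ξ (B y) = c ξ y :=
    calc ξ (B y) = η (p.symm (ψ (ξ.smulRight w) y)) :=
        apply_evalEquiv_symm_apply _ _ ξ (β y)
      _ = c ξ y := by simp [hc, hη]
  refine ⟨B, fun T y => ?_⟩
  have hT : T = ∑ i, ((finBasis F V).coord i).smulRight (T (finBasis F V i)) :=
    (finBasis F V).ext fun i => by simp [Finsupp.single_apply]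
  rw [hT, map_sum]
  simp only [LinearMap.sum_apply, hc, smulRight_apply, hB, map_sum]

end Factorization

section Semilinear

variable {F V W : Type*} [Field F] [AddCommGroup V] [Module F V] [AddCommGroup W] [Module F W]
  {σ σ' : F →+* F}

theorem finrank_eq_of_semilinearEquiv [RingHomInvPair σ σ'] [RingHomInvPair σ' σ]
    (e : V ≃ₛₗ[σ] W) : finrank F V = finrank F W := by
  have h := lift_rank_eq_of_equiv_equiv σ e.toAddEquiv
    (RingHomInvPair.toRingEquiv σ σ').bijective (map_smulₛₗ e)
  simpa [finrank] using congr_arg Cardinal.toNat h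

theorem bijective_of_injective_of_finrank_le [RingHomInvPair σ σ'] [RingHomInvPair σ' σ]
    [FiniteDimensional F W] {p : V →ₛₗ[σ] W} (hp : Function.Injective p)
    (h : finrank F W ≤ finrank F V) : Function.Bijective p := by
  refine ⟨hp, range_eq_top.1 (Submodule.eq_top_of_finrank_eq (le_antisymm ?_ ?_))⟩
  · exact Submodule.finrank_le _
  · rwa [← finrank_eq_of_semilinearEquiv (LinearEquiv.ofInjective p hp)]

end Semilinear

section Classification

variable {F V V' : Type*} [Field F] [AddCommGroup V] [Module F V] [AddCommGroup V'] [Module F V']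

theorem flip_smulRight (ξ : Dual F V) (ω : Dual F V') :
    (ξ.smulRight ω).flip = ω.smulRight ξ := by
  ext; simp [mul_comm]

theorem rank_flip_le_one {f : V →ₗ[F] Dual F V'} (hf : f.rank ≤ 1) : f.flip.rank ≤ 1 := by
  rcases eq_or_ne f 0 with rfl | hf0
  · exact rank_zero.trans_le zero_le_one
  · obtain ⟨ξ, ω, -, rfl⟩ := exists_eq_smulRight_of_rank_le_one hf hf0
    exact flip_smulRight ξ ω ▸ rank_smulRight_le_one ω ξ

variable [FiniteDimensional F V] [FiniteDimensional F V'] {σ σ' : F →+* F} [RingHomInvPair σ σ']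
  [RingHomInvPair σ' σ] {ψ : (V →ₗ[F] Dual F V') ≃ₛₗ[σ] (V →ₗ[F] Dual F V')}

theorem exists_eq_comp_or_flip_eq_comp [Nontrivial V] (hdim : finrank F V ≤ finrank F V')
    (hψ : ∀ f, f.rank ≤ 1 → (ψ f).rank ≤ 1) :
    (∃ (p : Dual F V' ≃ₛₗ[σ] Dual F V') (B : V →ₛₗ[σ'] V), ∀ f x, ψ f x = p (f (B x))) ∨
      ∃ (p : Dual F V' ≃ₛₗ[σ] Dual F V) (B : V' →ₛₗ[σ'] V),
        ∀ f x', (ψ f).flip x' = p (f (B x')) := by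
  have : Nontrivial V' := nontrivial_of_finrank_pos (finrank_pos.trans_le hdim)
  obtain ⟨ξ₁, hξ₁⟩ := exists_ne (0 : Dual F V)
  obtain ⟨ω₁, hω₁⟩ := exists_ne (0 : Dual F V')
  let S : Dual F V' →ₛₗ[σ] V →ₗ[F] Dual F V' := ψ.toLinearMap ∘ₛₗ smulRightₗ ξ₁
  have hS (ω : Dual F V') (h : S ω = 0) : ω = 0 := by
    simpa [S, hξ₁] using h
  rcases exists_common_factor (S := S) (fun ω => hψ _ (rank_smulRight_le_one ξ₁ ω))
    (fun h => hω₁ (hS ω₁ congr($h ω₁))) with ⟨η, hη, p, hp⟩ | ⟨ω, hω, p, hp⟩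
  · have hpb : Function.Bijective p := bijective_of_injective_of_finrank_le
      ((injective_iff_map_eq_zero p).2 fun ω h => hS ω (by ext; simp [hp, h])) le_rfl
    obtain ⟨B, hB⟩ := exists_eq_comp (ψ := ψ.toLinearMap) (p := .ofBijective p hpb)
      ψ.injective hψ hη hp
    exact .inl ⟨.ofBijective p hpb, B, hB⟩
  · have hpb : Function.Bijective p := bijective_of_injective_of_finrank_le
      ((injective_iff_map_eq_zero p).2 fun ω' h => hS ω' (by ext; simp [hp, h])) (by simpa)
    let ψ' : (V →ₗ[F] Dual F V') →ₛₗ[σ] V' →ₗ[F] Dual F V := lflip.toLinearMap ∘ₛₗ ψ.toLinearMap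
    obtain ⟨B, hB⟩ := exists_eq_comp (ψ := ψ') (p := .ofBijective p hpb)
      (fun _ _ h => ψ.injective (flip_inj h)) (fun f hf => rank_flip_le_one (hψ f hf)) hω
      (fun ω' => (congr_arg LinearMap.flip (hp ω')).trans (flip_smulRight _ _))
    exact .inr ⟨.ofBijective p hpb, B, hB⟩

end Classification

/-! ### Gabidulin codes as sets of linear maps -/

section Gabidulin

variable {F L V V' W : Type*} [Field F] [Field L] [Algebra F L] [AddCommGroup V] [Module F V]
  [AddCommGroup V'] [Module F V'] [AddCommGroup W] [Module F W] {σ σ' : F →+* F}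
  [RingHomInvPair σ σ'] [RingHomInvPair σ' σ]

/-- The linearized polynomial `y ↦ a₀ y + a₁ φ(y) + ⋯ + a_{t-1} φ^{t-1}(y)`, as a linear map. For
`φ = (y ↦ y^{q^j})` this is the `q^j`-polynomial with coefficients `a`. -/
def linearizedPoly (φ : L ≃ₐ[F] L) {t : ℕ} (a : Fin t → L) : L →ₗ[F] L :=
  ∑ h, mulLeft F (a h) ∘ₗ (φ ^ (h : ℕ)).toLinearMap

@[simp]
theorem linearizedPoly_apply (φ : L ≃ₐ[F] L) {t : ℕ} (a : Fin t → L) (y : L) :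
    linearizedPoly φ a y = ∑ h, a h * (φ ^ (h : ℕ)) y := by
  simp [linearizedPoly, LinearMap.sum_apply]

/-- Coordinate-free form of a generalized Gabidulin code: the maps `A ∘ P ∘ γ`, where `P` runs over
the linearized polynomials with `t` terms in `φ`. The outer maps may be semilinear, with inverse
companions, so that this form is kept under equivalence. -/
def gabidulinMaps (φ : L ≃ₐ[F] L) (t : ℕ) (A : L ≃ₛₗ[σ] W) (γ : V →ₛₗ[σ'] L) :
    Set (V →ₗ[F] W) :=
  Set.range fun a : Fin t → L => A.toLinearMap ∘ₛₗ linearizedPoly φ a ∘ₛₗ γ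

theorem eq_gabidulinMaps_of_image_congrRight_eq {W' : Type*} [AddCommGroup W'] [Module F W']
    (e : W' ≃ₗ[F] W) {S : Set (V →ₗ[F] W')} {φ : L ≃ₐ[F] L} {t : ℕ} {A : L ≃ₛₗ[σ] W}
    {γ : V →ₛₗ[σ'] L} (h : e.congrRight '' S = gabidulinMaps φ t A γ) :
    S = gabidulinMaps φ t (A.trans e.symm) γ := by
  rw [← e.congrRight.injective.image_injective.eq_iff, h, gabidulinMaps, gabidulinMaps,
    ← Set.range_comp]
  refine congr_arg _ (funext fun a => ?_)
  ext x : 1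
  exact (e.apply_symm_apply _).symm

theorem image_gabidulinMaps_of_eq_comp {ψ : (V →ₗ[F] Dual F V') ≃ₛₗ[σ] (V →ₗ[F] Dual F V')}
    {p : Dual F V' ≃ₛₗ[σ] Dual F V'} {B : V →ₛₗ[σ'] V} (hB : ∀ f x, ψ f x = p (f (B x)))
    (φ : L ≃ₐ[F] L) (t : ℕ) (Φ : L ≃ₗ[F] Dual F V') (γ : V →ₗ[F] L) :
    ψ '' gabidulinMaps φ t Φ γ = gabidulinMaps φ t (Φ.trans p) (γ ∘ₛₗ B) := by
  rw [gabidulinMaps, ← Set.range_comp]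
  refine congr_arg _ (funext fun a => ?_)
  ext x : 1
  simp [hB]

theorem trace_linearizedPoly_mul (φ : L ≃ₐ[F] L) {t : ℕ} (a : Fin t → L) (y z : L) :
    Algebra.trace F L (linearizedPoly φ a y * z) =
      Algebra.trace F L (linearizedPoly φ⁻¹ (fun h => (φ⁻¹ ^ (h : ℕ)) (a h)) z * y) := by
  simp only [linearizedPoly_apply, Finset.sum_mul, map_sum]
  refine Finset.sum_congr rfl fun h _ => ?_
  rw [← Algebra.trace_eq_of_algEquiv (φ⁻¹ ^ (h : ℕ)), map_mul (φ⁻¹ ^ (h : ℕ)),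
    map_mul (φ⁻¹ ^ (h : ℕ)), ← AlgEquiv.mul_apply, inv_pow, inv_mul_cancel, AlgEquiv.one_apply,
    mul_right_comm]

variable [FiniteDimensional F L] [Algebra.IsSeparable F L]

variable (F L) in
/-- The isomorphism of `L` with its dual given by the trace form, through which a bilinear form on
`V × L` becomes a linear map `V → L`. -/
noncomputable def traceDual : L ≃ₗ[F] Dual F L :=
  (Algebra.traceForm F L).toDual (traceForm_nondegenerate F L)

@[simp]
theorem traceDual_apply (y z : L) : traceDual F L y z = Algebra.trace F L (y * z) := rfl

theorem exists_apply_eq_trace (q : L →ₛₗ[σ] Dual F V) :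
    ∃ r : V →ₛₗ[σ'] L, ∀ y x, q y x = σ (Algebra.trace F L (y * r x)) := by
  let β : V →ₛₗ[σ'] Dual F L := mk₂'ₛₗ σ' (RingHom.id F) (fun x y => σ' (q y x))
    (by simp) (by simp) (by simp) (by simp [map_smulₛₗ])
  refine ⟨(traceDual F L).symm.toLinearMap ∘ₛₗ β, fun y x => ?_⟩
  have h := congr($((traceDual F L).apply_symm_apply (β x)) y)
  rw [traceDual_apply, mul_comm] at h
  calc q y x = σ (β x y) := (RingHomInvPair.comp_apply_eq₂ (σ := σ)).symm
    _ = _ := by rw [← h]; rfl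

theorem exists_trace_eq_apply [FiniteDimensional F V] (hdim : finrank F V = finrank F L)
    {r : V →ₛₗ[σ'] L} (hr : Function.Injective r) :
    ∃ A : L ≃ₛₗ[σ] Dual F V, ∀ y x, A y x = σ (Algebra.trace F L (y * r x)) := by
  let q : L →ₛₗ[σ] Dual F V :=
    mk₂'ₛₗ σ (RingHom.id F) (fun y x => σ (Algebra.trace F L (y * r x)))
      (by simp [add_mul]) (by simp) (by simp [mul_add]) (by simp [map_smulₛₗ])
  have hrb := bijective_of_injective_of_finrank_le hr hdim.ge
  have hq : Function.Injective q := by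
    refine (injective_iff_map_eq_zero q).2 fun y hy => ?_
    rw [← (traceDual F L).map_eq_zero_iff]
    ext z
    obtain ⟨x, rfl⟩ := hrb.2 z
    simpa [q] using congr($hy x)
  exact ⟨.ofBijective q (bijective_of_injective_of_finrank_le hq (by simp [hdim])), fun _ _ => rfl⟩

theorem injective_of_flip_eq_comp [Nontrivial V]
    {ψ : (V →ₗ[F] Dual F V') ≃ₛₗ[σ] (V →ₗ[F] Dual F V')}
    {p : Dual F V' ≃ₛₗ[σ] Dual F V} {B : V' →ₛₗ[σ'] V}
    (hB : ∀ f x', (ψ f).flip x' = p (f (B x'))) : Function.Injective B := by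
  refine (injective_iff_map_eq_zero B).2 fun x' hx' => ?_
  by_contra h
  obtain ⟨ω, hω⟩ := Projective.exists_dual_eq_one F h
  obtain ⟨x, hx⟩ := exists_ne (0 : V)
  obtain ⟨ξ, hξ⟩ := Projective.exists_dual_eq_one F hx
  obtain ⟨f, hf⟩ := ψ.surjective (ξ.smulRight ω)
  have := hB f x'
  simpa [hx', hf, hξ, hω] using congr($this x)

theorem exists_image_gabidulinMaps_of_flip_eq_comp [Nontrivial V] [FiniteDimensional F V']
    {ψ : (V →ₗ[F] Dual F V') ≃ₛₗ[σ] (V →ₗ[F] Dual F V')} {p : Dual F V' ≃ₛₗ[σ] Dual F V}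
    {B : V' →ₛₗ[σ'] V} (hB : ∀ f x', (ψ f).flip x' = p (f (B x'))) (φ : L ≃ₐ[F] L) (t : ℕ)
    (Φ : L ≃ₗ[F] Dual F V') {γ : V →ₗ[F] L} (hγ : Function.Injective γ) :
    ∃ (A : L ≃ₛₗ[σ] Dual F V') (γ' : V →ₛₗ[σ'] L),
      ψ '' gabidulinMaps φ t Φ γ = gabidulinMaps φ⁻¹ t A γ' := by
  obtain ⟨r, hr⟩ := exists_apply_eq_trace (Φ.trans p).toLinearMap
  obtain ⟨A, hA⟩ := exists_trace_eq_apply (r := γ ∘ₛₗ B) (by simpa using Φ.finrank_eq.symm)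
    (hγ.comp (injective_of_flip_eq_comp hB))
  let e : (Fin t → L) ≃ (Fin t → L) :=
    Equiv.piCongrRight fun h => (φ⁻¹ ^ (h : ℕ)).toEquiv
  refine ⟨A, r, ?_⟩
  rw [gabidulinMaps, gabidulinMaps, ← Set.range_comp,
    ← e.surjective.range_comp fun a => A.toLinearMap ∘ₛₗ linearizedPoly φ⁻¹ a ∘ₛₗ r]
  refine congr_arg _ (funext fun a => ?_)
  ext x x'
  calc ψ (Φ.toLinearMap ∘ₗ linearizedPoly φ a ∘ₗ γ) x x'
      = p (Φ (linearizedPoly φ a (γ (B x')))) x :=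
        congr($(hB (Φ.toLinearMap ∘ₗ linearizedPoly φ a ∘ₗ γ) x') x)
    _ = σ (Algebra.trace F L (linearizedPoly φ a (γ (B x')) * r x)) := hr _ x
    _ = σ (Algebra.trace F L (linearizedPoly φ⁻¹ (e a) (r x) * γ (B x'))) :=
      congr_arg σ (trace_linearizedPoly_mul φ a _ _)
    _ = A (linearizedPoly φ⁻¹ (e a) (r x)) x' := (hA _ x').symm

theorem exists_image_gabidulinMaps_eq [Nontrivial V] [FiniteDimensional F V]
    [FiniteDimensional F V'] (hdim : finrank F V ≤ finrank F V')
    {ψ : (V →ₗ[F] Dual F V') ≃ₛₗ[σ] (V →ₗ[F] Dual F V')}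
    (hψ : ∀ f, f.rank ≤ 1 → (ψ f).rank ≤ 1) (φ : L ≃ₐ[F] L) (t : ℕ)
    (Φ : L ≃ₗ[F] Dual F V') {γ : V →ₗ[F] L} (hγ : Function.Injective γ) :
    ∃ φ' ∈ ({φ, φ⁻¹} : Set (L ≃ₐ[F] L)), ∃ (A : L ≃ₛₗ[σ] Dual F V') (γ' : V →ₛₗ[σ'] L),
      ψ '' gabidulinMaps φ t Φ γ = gabidulinMaps φ' t A γ' := by
  rcases exists_eq_comp_or_flip_eq_comp hdim hψ with ⟨p, B, hB⟩ | ⟨p, B, hB⟩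
  · exact ⟨φ, .inl rfl, Φ.trans p, γ ∘ₛₗ B, image_gabidulinMaps_of_eq_comp hB φ t Φ γ⟩
  · exact ⟨φ⁻¹, .inr rfl, exists_image_gabidulinMaps_of_flip_eq_comp hB φ t Φ hγ⟩

end Gabidulin

section FiniteField

variable {F L : Type*} [Field F] [Fintype F] [Field L] [Algebra F L] [FiniteDimensional F L]

theorem frobeniusAlgEquivOfAlgebraic_pow_apply (j : ℕ) (y : L) :
    (FiniteField.frobeniusAlgEquivOfAlgebraic F L ^ j) y = y ^ Fintype.card F ^ j := by
  rw [AlgEquiv.coe_pow, FiniteField.coe_frobeniusAlgEquivOfAlgebraic_iterate]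

theorem zpowers_frobeniusAlgEquivOfAlgebraic_pow_eq_top {j : ℕ}
    (hj : j.Coprime (finrank F L)) :
    Subgroup.zpowers (FiniteField.frobeniusAlgEquivOfAlgebraic F L ^ j) = ⊤ := by
  have : Finite L := Module.finite_of_finite F
  refine Subgroup.eq_top_of_card_eq _ ?_
  rw [Nat.card_zpowers, IsGalois.card_aut_eq_finrank, Nat.Coprime.orderOf_pow,
    FiniteField.orderOf_frobeniusAlgEquivOfAlgebraic]
  rw [FiniteField.orderOf_frobeniusAlgEquivOfAlgebraic]
  exact hj.symm

end FiniteField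

section Codes

variable {F V V' : Type*} [Field F] [AddCommGroup V] [Module F V] [AddCommGroup V'] [Module F V']

theorem rank_le_one_iff_formRank_le_one [FiniteDimensional F V] (f : V →ₗ[F] V' →ₗ[F] F) :
    f.rank ≤ 1 ↔ formRank f ≤ 1 := by
  rw [formRank, ← finrank_range_add_finrank_ker f, Nat.add_sub_cancel, LinearMap.rank,
    ← finrank_eq_rank, Nat.cast_le_one]

variable {L : Type*} [Fintype F] [Field L] [Algebra F L] [FiniteDimensional F L]

theorem IsGeneralizedGabidulin.exists_eq_gabidulinMaps {G : Set (V →ₗ[F] V' →ₗ[F] F)}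
    (hG : IsGeneralizedGabidulin F L G) :
    ∃ φ : L ≃ₐ[F] L, Subgroup.zpowers φ = ⊤ ∧ ∃ (t : ℕ) (Φ : L ≃ₗ[F] Dual F V') (γ : V →ₗ[F] L),
      Function.Injective γ ∧ G = gabidulinMaps φ t Φ γ := by
  obtain ⟨m, n, b, b', u, g, t, j, hg, -, -, -, hj, rfl⟩ := hG
  refine ⟨_, zpowers_frobeniusAlgEquivOfAlgebraic_pow_eq_top (j := j)
    (by rwa [finrank_eq_card_basis u, Fintype.card_fin]), t, u.equivFun.trans (b'.constr F),
    b.constr F g, b.injective_constr_of_linearIndependent hg,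
    Set.ext fun f => exists_congr fun a => ?_⟩
  simp only [toMatrix₂_apply]
  refine ⟨fun h => b.ext fun i => b'.ext fun l => ?_, ?_⟩
  · simp [h, frobeniusAlgEquivOfAlgebraic_pow_apply, ← pow_mul]
  · rintro rfl i l
    simp [frobeniusAlgEquivOfAlgebraic_pow_apply, ← pow_mul]

theorem exists_eq_gabidulinMaps_of_codeEquivalent [Nontrivial V] [FiniteDimensional F V]
    [FiniteDimensional F V'] (hdim : finrank F V ≤ finrank F V')
    {P G : Set (V →ₗ[F] V' →ₗ[F] F)} (hG : IsGeneralizedGabidulin F L G)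
    (hPG : CodeEquivalent P G) :
    ∃ φ : L ≃ₐ[F] L, Subgroup.zpowers φ = ⊤ ∧ ∃ (σ σ' : F →+* F) (_ : RingHomInvPair σ σ')
      (_ : RingHomInvPair σ' σ) (t : ℕ) (A : L ≃ₛₗ[σ] Dual F V') (γ : V →ₛₗ[σ'] L),
      P = gabidulinMaps φ t A γ := by
  obtain ⟨σ, e, hsmul, hrank, rfl⟩ := hPG
  obtain ⟨φ, hφ, t, Φ, γ, hγ, hG⟩ := hG.exists_eq_gabidulinMaps
  have := RingHomInvPair.of_ringEquiv σ
  have := RingHomInvPair.of_ringEquiv_symm σ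
  let ψ : (V →ₗ[F] V' →ₗ[F] F) ≃ₛₗ[(σ : F →+* F)] (V →ₗ[F] V' →ₗ[F] F) :=
    { e with map_smul' := hsmul }
  have hψ (f : V →ₗ[F] V' →ₗ[F] F) : formRank (ψ.symm f) = formRank f := by
    rw [← hrank]
    exact congr_arg formRank (ψ.apply_symm_apply f)
  obtain ⟨φ', hφ', A, γ', h⟩ := exists_image_gabidulinMaps_eq hdim (ψ := ψ.symm)
    (fun f hf => by
      rwa [rank_le_one_iff_formRank_le_one, hψ, ← rank_le_one_iff_formRank_le_one]) φ t Φ hγ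
  refine ⟨φ', ?_, _, _, _, _, t, A, γ', ?_⟩
  · rcases hφ' with rfl | rfl
    · exact hφ
    · rwa [Subgroup.zpowers_inv]
  · rw [← h, ← hG]
    exact (ψ.toEquiv.symm_image_image P).symm

end Codes

/-! ### Coefficient vectors of twisted codes -/

section TwistedCoeffs

variable {G M M' : Type*} [Group G] {τ : G} {t i : ℕ}

theorem pow_eq_pow_iff_of_lt_orderOf {j : ℕ} (hi : i < orderOf τ) (hj : j < orderOf τ) :
    τ ^ i = τ ^ j ↔ i = j :=
  pow_injOn_Iio_orderOf.eq_iff hi hj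

theorem exists_pow_eq_of_zpowers_eq_top [Finite G] (hτ : Subgroup.zpowers τ = ⊤) (g : G) :
    ∃ i < orderOf τ, τ ^ i = g := by
  classical
  simpa using mem_zpowers_iff_mem_range_orderOf.1 (hτ ▸ Subgroup.mem_top g)

theorem apply_pow_eq_of_forall_apply_mul_eq {δ e r : ℕ} {ρ : M → M'} {v : G → M}
    {w : G → M'} (h : ∀ g, w (τ ^ δ * g) = ρ (v g))
    (her : e + δ = r ∨ e + δ = r + orderOf τ) : w (τ ^ r) = ρ (v (τ ^ e)) := by
  have hr : τ ^ r = τ ^ δ * τ ^ e := by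
    rw [← pow_add, add_comm]
    rcases her with her | her <;> simp [her, pow_add, pow_orderOf_eq_one]
  rw [hr, h]

variable [Zero M]

/-- The vectors indexed by powers of `τ` that are supported on `1, τ, …, τ^t` and whose last entry
is the image under `N` of the first one. With `N a = μ a^{q^{sk}}`, up to normalization, they are
the coefficient vectors of a generalized twisted Gabidulin code. -/
def twistedCoeffs (τ : G) (t : ℕ) (N : M → M) : Set (G → M) :=
  {v | (∀ i, t < i → i < orderOf τ → v (τ ^ i) = 0) ∧ v (τ ^ t) = N (v 1)}

variable {N : M → M}

theorem update_mem_twistedCoeffs [DecidableEq G] (ht0 : 0 < t) (ht : t < orderOf τ) {v : G → M}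
    (hv : ∀ i, t < i → i < orderOf τ → v (τ ^ i) = 0) :
    Function.update v (τ ^ t) (N (v 1)) ∈ twistedCoeffs τ t N := by
  have h1 : (1 : G) ≠ τ ^ t := (pow_ne_one_of_lt_orderOf ht0.ne' ht).symm
  refine ⟨fun i hti hi => ?_, by simp [h1]⟩
  have hit : τ ^ i ≠ τ ^ t := mt (pow_eq_pow_iff_of_lt_orderOf hi ht).1 hti.ne'
  rw [Function.update_of_ne hit, hv i hti hi]

theorem single_mem_twistedCoeffs [DecidableEq G] (hN : N 0 = 0) (hi0 : 0 < i) (hit : i < t)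
    (ht : t < orderOf τ) (c : M) : Pi.single (τ ^ i) c ∈ twistedCoeffs τ t N := by
  have h1 : (1 : G) ≠ τ ^ i := (pow_ne_one_of_lt_orderOf hi0.ne' (hit.trans ht)).symm
  have hne {j : ℕ} (hj : j < orderOf τ) (hij : i < j) : τ ^ j ≠ τ ^ i :=
    mt (pow_eq_pow_iff_of_lt_orderOf hj (hij.trans hj)).1 hij.ne'
  exact ⟨fun j htj hj => Pi.single_eq_of_ne (hne hj (hit.trans htj)) _, by
    rw [Pi.single_eq_of_ne (hne ht hit), Pi.single_eq_of_ne h1, hN]⟩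

theorem exists_mem_twistedCoeffs_apply_eq {r₁ r₂ : ℕ} (h₁ : r₁ < t) (h₂ : r₂ < t) (hr : r₁ ≠ r₂)
    (ht : t < orderOf τ) (p₁ p₂ : M) :
    ∃ v ∈ twistedCoeffs τ t N, v (τ ^ r₁) = p₁ ∧ v (τ ^ r₂) = p₂ := by
  classical
  have hne {i j : ℕ} (hi : i < orderOf τ) (hj : j < orderOf τ) (hij : i ≠ j) : τ ^ i ≠ τ ^ j :=
    mt (pow_eq_pow_iff_of_lt_orderOf hi hj).1 hij
  refine ⟨_, update_mem_twistedCoeffs (v := Function.update (Pi.single (τ ^ r₁) p₁) (τ ^ r₂) p₂)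
    (by lia) ht fun i hti hi => ?_, ?_, ?_⟩
  · rw [Function.update_of_ne (hne hi (by lia) (by lia)),
      Pi.single_eq_of_ne (hne hi (by lia) (by lia))]
  · rw [Function.update_of_ne (hne (by lia) ht (by lia)),
      Function.update_of_ne (hne (by lia) (by lia) hr), Pi.single_eq_same]
  · rw [Function.update_of_ne (hne (by lia) ht (by lia)), Function.update_self]

theorem apply_pow_eq_zero_iff_of_mem_twistedCoeffs (hN0 : N 0 = 0) (hN : Function.Injective N)
    {v : G → M} (hv : v ∈ twistedCoeffs τ t N) : v (τ ^ t) = 0 ↔ v (τ ^ 0) = 0 := by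
  rw [hv.2, pow_zero]
  exact ⟨fun h => hN (h.trans hN0.symm), fun h => by rw [h, hN0]⟩

theorem exists_two_zeros {δ : ℕ} (hN0 : N 0 = 0) (hN : Function.Injective N) (ht : 2 ≤ t)
    (htm : t + 3 ≤ orderOf τ) (hδ0 : 0 < δ) (hδ : δ < orderOf τ) :
    ∃ r₁ r₂, r₁ < t ∧ r₂ < t ∧ r₁ ≠ r₂ ∧
      ∀ ρ : M → M, ρ 0 = 0 → Function.Injective ρ →
        ∀ v ∈ twistedCoeffs τ t N, ∀ w ∈ twistedCoeffs τ t N, (∀ g, w (τ ^ δ * g) = ρ (v g)) →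
          w (τ ^ r₁) = 0 ∧ w (τ ^ r₂) = 0 := by
  have hends {v : G → M} (hv : v ∈ twistedCoeffs τ t N) :=
    apply_pow_eq_zero_iff_of_mem_twistedCoeffs hN0 hN hv
  have hzero {ρ : M → M} (hρ0 : ρ 0 = 0) {v w : G → M} (hv : v ∈ twistedCoeffs τ t N)
      (h : ∀ g, w (τ ^ δ * g) = ρ (v g)) (e r : ℕ)
      (her : e + δ = r ∨ e + δ = r + orderOf τ) (hte : t < e) (he : e < orderOf τ) :
      w (τ ^ r) = 0 := by
    rw [apply_pow_eq_of_forall_apply_mul_eq h her, hv.1 e hte he, hρ0]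
  obtain rfl | h_last | h_small | h_large :
      δ = 1 ∨ δ + 1 = orderOf τ ∨ (2 ≤ δ ∧ δ ≤ t) ∨ (t < δ ∧ δ + 1 < orderOf τ) := by lia
  · refine ⟨0, 1, by lia, by lia, by lia, fun ρ hρ0 hρ v hv w hw h =>
      ⟨hzero hρ0 hv h (orderOf τ - 1) 0 (by lia) (by lia) (by lia), ?_⟩⟩
    have hvt : v (τ ^ t) = 0 := hρ (by
      rw [hρ0, ← apply_pow_eq_of_forall_apply_mul_eq h (.inl rfl),
        hw.1 (t + 1) (by lia) (by lia)])
    rw [apply_pow_eq_of_forall_apply_mul_eq h (.inl (zero_add 1)), (hends hv).1 hvt, hρ0]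
  · refine ⟨0, t - 1, by lia, by lia, by lia, fun ρ hρ0 hρ v hv w hw h =>
      ⟨(hends hw).1 (hzero hρ0 hv h (t + 1) t (by lia) (by lia) (by lia)), ?_⟩⟩
    have hv0 : v (τ ^ 0) = 0 := hρ (by
      rw [hρ0, ← apply_pow_eq_of_forall_apply_mul_eq h (.inl (zero_add δ)),
        hw.1 δ (by lia) (by lia)])
    rw [apply_pow_eq_of_forall_apply_mul_eq (e := t) h (.inr (by lia)), (hends hv).2 hv0, hρ0]
  · exact ⟨δ - 1, δ - 2, by lia, by lia, by lia, fun ρ hρ0 _ v hv w _ h =>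
      ⟨hzero hρ0 hv h (orderOf τ - 1) _ (by lia) (by lia) (by lia),
        hzero hρ0 hv h (orderOf τ - 2) _ (by lia) (by lia) (by lia)⟩⟩
  · exact ⟨0, t - 1, by lia, by lia, by lia, fun ρ hρ0 _ v hv w hw h =>
      ⟨(hends hw).1
          (hzero hρ0 hv h (t + orderOf τ - δ) t (by lia) (by lia) (by lia)),
        hzero hρ0 hv h (t - 1 + orderOf τ - δ) (t - 1) (by lia) (by lia) (by lia)⟩⟩

end TwistedCoeffs

theorem single_one_add_single_mem_twistedCoeffs {G M : Type*} [Group G] [DecidableEq G]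
    [AddZeroClass M] {τ : G} {t : ℕ} (ht0 : 0 < t) (ht : t < orderOf τ) (N : M → M) (a : M) :
    Pi.single 1 a + Pi.single (τ ^ t) (N a) ∈ twistedCoeffs τ t N := by
  have hne {i : ℕ} (hi0 : 0 < i) (hi : i < orderOf τ) : τ ^ i ≠ 1 :=
    pow_ne_one_of_lt_orderOf hi0.ne' hi
  refine ⟨fun i hti hi => ?_, by simp [(hne ht0 ht).symm, hne ht0 ht]⟩
  simp [hne (ht0.trans hti) hi, (pow_eq_pow_iff_of_lt_orderOf hi ht).not.2 hti.ne']

/-! ### Expansion of linear maps in Galois automorphisms -/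

section Expansion

variable {F K L : Type*} [Field F] [Field K] [Field L] [Algebra F K] [Algebra K L]
  [FiniteDimensional F K]

/-- The effect of composition with the map `∑ d, B d` on coefficient vectors, where each `B d` is
semilinear over `K` with respect to `d`: such a `B d` shifts the indices by `d`. -/
noncomputable def coeffAction (B : ∀ d : Gal(K/F), L →ₛₗ[(d : K →+* K)] L)
    (v : Gal(K/F) → L) : Gal(K/F) → L :=
  fun g => ∑ d, B d (v (d⁻¹ * g))

variable {B : ∀ d : Gal(K/F), L →ₛₗ[(d : K →+* K)] L}

theorem coeffAction_add (B : ∀ d : Gal(K/F), L →ₛₗ[(d : K →+* K)] L) (v w : Gal(K/F) → L) :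
    coeffAction B (v + w) = coeffAction B v + coeffAction B w := by
  ext g
  simp [coeffAction, Finset.sum_add_distrib]

theorem coeffAction_single [DecidableEq Gal(K/F)] {d j r : Gal(K/F)} (h : d * j = r) (c : L) :
    coeffAction B (Pi.single j c) r = B d c := by
  subst h
  rw [coeffAction, Finset.sum_eq_single d (fun e _ hed => ?_) (by simp)]
  · simp
  · rw [Pi.single_eq_of_ne, map_zero]
    rw [Ne, inv_mul_eq_iff_eq_mul]
    exact fun h => hed (mul_right_cancel h).symm

variable [Algebra F L] [IsScalarTower F K L]

/-- The linear map `x ↦ ∑ g, g(x) v(g)` from `K` to `L` with coefficient vector `v`, in which the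
automorphisms of `K` take the place of the powers of the Frobenius modulo `q^m`-th powers. -/
noncomputable def ofGaloisCoeffs : (Gal(K/F) → L) →ₗ[L] (K →ₗ[F] L) :=
  Fintype.linearCombination L fun g => ((IsScalarTower.toAlgHom F K L).comp g).toLinearMap

theorem ofGaloisCoeffs_apply (v : Gal(K/F) → L) (x : K) :
    ofGaloisCoeffs v x = ∑ g, g x • v g := by
  simp [ofGaloisCoeffs, Fintype.linearCombination_apply, LinearMap.sum_apply, Algebra.smul_def,
    mul_comm]

theorem ofGaloisCoeffs_single [DecidableEq Gal(K/F)] (g : Gal(K/F)) (c : L) (x : K) :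
    ofGaloisCoeffs (Pi.single g c) x = g x • c := by
  rw [ofGaloisCoeffs_apply, Finset.sum_eq_single g (fun h _ hhg => by simp [hhg]) (by simp),
    Pi.single_eq_same]

theorem ofGaloisCoeffs_injective :
    Function.Injective (ofGaloisCoeffs : (Gal(K/F) → L) → (K →ₗ[F] L)) := by
  refine ((linearIndependent_toLinearMap F K L).comp
    (fun g : Gal(K/F) => (IsScalarTower.toAlgHom F K L).comp g) fun g h hgh =>
      AlgEquiv.ext fun x => ?_).fintypeLinearCombination_injective
  exact (algebraMap K L).injective congr($hgh x)

theorem map_ofGaloisCoeffs {d : Gal(K/F)} (B : L →ₛₗ[(d : K →+* K)] L) (v : Gal(K/F) → L)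
    (x : K) : B (ofGaloisCoeffs v x) = ofGaloisCoeffs (fun g => B (v (d⁻¹ * g))) x := by
  simp only [ofGaloisCoeffs_apply, map_sum, map_smulₛₗ]
  refine Eq.trans ?_ (Equiv.sum_comp (Equiv.mulLeft d) _)
  simp

theorem sum_apply_ofGaloisCoeffs (B : ∀ d : Gal(K/F), L →ₛₗ[(d : K →+* K)] L)
    (v : Gal(K/F) → L) (x : K) :
    ∑ d, B d (ofGaloisCoeffs v x) = ofGaloisCoeffs (coeffAction B v) x := by
  simp only [map_ofGaloisCoeffs]
  simp only [ofGaloisCoeffs_apply, coeffAction, Finset.smul_sum]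
  exact Finset.sum_comm

theorem exists_semilinear_decomposition [IsGalois F L] [FiniteDimensional F L] [Normal F K]
    (A : L →ₗ[F] L) :
    ∃ B : ∀ d : Gal(K/F), L →ₛₗ[(d : K →+* K)] L, ∀ y, A y = ∑ d, B d y := by
  classical
  have hspan := (linearIndependent_toLinearMap F L L).comp _
    (algEquivEquivAlgHom F L).injective |>.span_eq_top_of_card_eq_finrank' (by
      rw [Module.finrank_linearMap_self, ← IsGalois.card_aut_eq_finrank F L,
        Nat.card_eq_fintype_card])
  obtain ⟨a, rfl⟩ := (Submodule.mem_span_range_iff_exists_fun L).1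
    (hspan ▸ Submodule.mem_top (x := A))
  have hsmul (g : Gal(L/F)) (κ : K) (y : L) :
      g (κ • y) = AlgEquiv.restrictNormalHom K g κ • g y := by
    rw [Algebra.smul_def, map_mul, Algebra.smul_def]
    exact congr_arg (· * g y) (AlgEquiv.restrictNormal_commutes g K κ).symm
  refine ⟨fun d =>
    { toFun := fun y => ∑ g with AlgEquiv.restrictNormalHom K g = d, a g * g y
      map_add' := fun y z => by simp [mul_add, Finset.sum_add_distrib]
      map_smul' := fun κ y => ?_ }, fun y => ?_⟩
  · rw [Finset.smul_sum]
    refine Finset.sum_congr rfl fun g hg => ?_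
    obtain rfl := (Finset.mem_filter.1 hg).2
    rw [hsmul, mul_smul_comm]
    rfl
  · simpa using (Finset.sum_fiberwise Finset.univ (AlgEquiv.restrictNormalHom K) _).symm

end Expansion

section Stabilizer

theorem eq_zero_of_map_smul {K M M' S : Type*} [Field K] [AddCommGroup M] [Module K M] [SMul K M']
    [FunLike S K K] {σ₁ σ₂ : S} (hσ : σ₁ ≠ σ₂) {f : M' → M} {y : M'}
    (h₁ : ∀ κ : K, f (κ • y) = σ₁ κ • f y) (h₂ : ∀ κ : K, f (κ • y) = σ₂ κ • f y) : f y = 0 := by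
  obtain ⟨κ, hκ⟩ := DFunLike.ne_iff.1 hσ
  by_contra h
  exact hκ (smul_left_injective K h ((h₁ κ).symm.trans (h₂ κ)))

variable {F K L : Type*} [Field F] [Field K] [Field L] [Algebra F K] [Algebra K L]
  [FiniteDimensional F K]

variable {B : ∀ d : Gal(K/F), L →ₛₗ[(d : K →+* K)] L}
  {τ ε : Gal(K/F)} {N : L →ₛₗ[(ε : K →+* K)] L} {t i : ℕ}

theorem eq_zero_of_lt_of_coeffAction_mem (hN : Function.Surjective N) (ht0 : 0 < t) (hε : ε ≠ τ ^ t)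
    (hB : ∀ v ∈ twistedCoeffs τ t N, coeffAction B v ∈ twistedCoeffs τ t N)
    (hti : t < i) (hi : i < orderOf τ) : B (τ ^ i) = 0 ∧ B (τ ^ (i - t)) = 0 := by
  classical
  have hcancel : τ ^ (i - t) * τ ^ t = τ ^ i := by rw [← pow_add, Nat.sub_add_cancel hti.le]
  have hsum (a : L) : B (τ ^ i) a + B (τ ^ (i - t)) (N a) = 0 := by
    have hmem := hB _ (single_one_add_single_mem_twistedCoeffs ht0 (hti.trans hi) N a)
    rw [← hmem.1 i hti hi, coeffAction_add, Pi.add_apply, coeffAction_single (mul_one _),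
      coeffAction_single hcancel]
  have hzero (a : L) : B (τ ^ i) a = 0 := by
    refine eq_zero_of_map_smul (σ₁ := τ ^ i) (σ₂ := τ ^ (i - t) * ε) (fun h => hε ?_)
      (fun κ => map_smulₛₗ _ κ a) fun κ => ?_
    · rw [← hcancel] at h
      exact (mul_left_cancel h).symm
    · rw [eq_neg_of_add_eq_zero_left (hsum _), eq_neg_of_add_eq_zero_left (hsum a), map_smulₛₗ,
        map_smulₛₗ, smul_neg]
      rfl
  refine ⟨LinearMap.ext hzero, LinearMap.ext fun b => ?_⟩
  obtain ⟨a, rfl⟩ := hN b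
  simpa [hzero] using hsum a

theorem eq_zero_of_coeffAction_mem (hN : Function.Surjective N) (ht0 : 0 < t)
    (ht : t + 2 ≤ orderOf τ) (hε : ε ≠ τ ^ t)
    (hB : ∀ v ∈ twistedCoeffs τ t N, coeffAction B v ∈ twistedCoeffs τ t N)
    (hi0 : 0 < i) (hi : i < orderOf τ) : B (τ ^ i) = 0 := by
  classical
  have hlarge {j : ℕ} := eq_zero_of_lt_of_coeffAction_mem (i := j) hN ht0 hε hB
  obtain hti | hit | ⟨rfl, hi2⟩ | hit :
      t < i ∨ i + t < orderOf τ ∨ (i = t ∧ 2 ≤ i) ∨ i < t := by lia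
  · exact (hlarge hti hi).1
  · have h := (hlarge (j := i + t) (by lia) hit).2
    rwa [Nat.add_sub_cancel] at h
  · ext c
    rw [LinearMap.zero_apply, ← coeffAction_single (B := B) (pow_add τ i 1).symm c]
    exact (hB _ (single_mem_twistedCoeffs (i := 1) (map_zero N) one_pos (by lia) hi c)).1 (i + 1)
      (by lia) (by lia)
  · have hmem (c : L) : coeffAction B (Pi.single (τ ^ (t - i)) c) ∈ twistedCoeffs τ t N :=
      hB _ (single_mem_twistedCoeffs (map_zero N) (by lia) (by lia) (by lia) c)
    have hcancel : τ ^ i * τ ^ (t - i) = τ ^ t := by rw [← pow_add, Nat.add_sub_cancel' hit.le]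
    have hcomp (c : L) : B (τ ^ i) c = N (B (τ ^ (t - i))⁻¹ c) := by
      have h := (hmem c).2
      rwa [coeffAction_single hcancel, coeffAction_single (inv_mul_cancel _)] at h
    ext c
    refine eq_zero_of_map_smul (σ₁ := τ ^ i) (σ₂ := ε * (τ ^ (t - i))⁻¹) (fun h => hε ?_)
      (fun κ => map_smulₛₗ _ κ c) fun κ => ?_
    · rw [← hcancel, h, inv_mul_cancel_right]
    · rw [hcomp, hcomp, map_smulₛₗ, map_smulₛₗ]
      rfl

theorem map_smul_of_comp_mem [Algebra F L] [IsScalarTower F K L] [FiniteDimensional F L]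
    [IsGalois F L] [Normal F K] (hτ : Subgroup.zpowers τ = ⊤) (hN : Function.Surjective N)
    (ht0 : 0 < t) (ht : t + 2 ≤ orderOf τ) (hε : ε ≠ τ ^ t) {Θ : L →ₗ[F] L}
    (hΘ : ∀ f ∈ ofGaloisCoeffs '' twistedCoeffs τ t N,
      Θ ∘ₗ f ∈ (ofGaloisCoeffs '' twistedCoeffs τ t N : Set (K →ₗ[F] L))) (κ : K) (y : L) :
    Θ (κ • y) = κ • Θ y := by
  obtain ⟨B, hB⟩ := exists_semilinear_decomposition (K := K) Θ
  have hmem (v : Gal(K/F) → L) (hv : v ∈ twistedCoeffs τ t N) :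
      coeffAction B v ∈ twistedCoeffs τ t N := by
    obtain ⟨w, hw, hwv⟩ := hΘ _ ⟨v, hv, rfl⟩
    suffices w = coeffAction B v from this ▸ hw
    refine ofGaloisCoeffs_injective (hwv.trans (LinearMap.ext fun x => ?_))
    rw [LinearMap.comp_apply, hB, sum_apply_ofGaloisCoeffs]
  have hzero (d : Gal(K/F)) (hd : d ≠ 1) : B d = 0 := by
    obtain ⟨i, hi, rfl⟩ := exists_pow_eq_of_zpowers_eq_top hτ d
    refine eq_zero_of_coeffAction_mem hN ht0 ht hε hmem (Nat.pos_of_ne_zero ?_) hi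
    rintro rfl
    exact hd (pow_zero τ)
  have hone (y : L) : Θ y = B 1 y := by
    rw [hB, Finset.sum_eq_single 1 (fun d _ hd => by rw [hzero d hd, LinearMap.zero_apply])
      (by simp)]
  rw [hone, hone, map_smulₛₗ]
  rfl

end Stabilizer

/-! ### Twisted codes are not Gabidulin codes -/

section Gabidulin

variable {F L V W : Type*} [Field F] [Field L] [Algebra F L] [AddCommGroup V] [Module F V]
  [AddCommGroup W] [Module F W] {σ σ' : F →+* F} [RingHomInvPair σ σ'] [RingHomInvPair σ' σ]
  {φ : L ≃ₐ[F] L} {t : ℕ} {A : L ≃ₛₗ[σ] W} {γ : V →ₛₗ[σ'] L}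

theorem conj_mulLeft_comp_mem_gabidulinMaps (l : L) {f : V →ₗ[F] W}
    (hf : f ∈ gabidulinMaps φ t A γ) : A.conj (mulLeft F l) ∘ₗ f ∈ gabidulinMaps φ t A γ := by
  obtain ⟨a, rfl⟩ := hf
  exact ⟨fun h => l * a h, by ext x; simp [mul_assoc, LinearEquiv.conj_apply]⟩

theorem exists_sub_eq_of_mem_gabidulinMaps {f : V →ₗ[F] W} (hf : f ∈ gabidulinMaps φ t A γ) :
    ∃ l, ∃ w ∈ gabidulinMaps φ t A γ, ∃ u ∈ gabidulinMaps φ t A γ,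
      (∀ x, (f - w) x = A (l * γ x)) ∧ ∀ x, w x = A (φ (A.symm (u x))) := by
  obtain ⟨a, rfl⟩ := hf
  rcases t with - | t
  · exact ⟨0, _, ⟨a, rfl⟩, _, ⟨a, rfl⟩, by simp, by simp⟩
  · refine ⟨a 0, _, ⟨Fin.cons 0 (Fin.tail a), rfl⟩, _,
      ⟨Fin.snoc (fun h => φ.symm (a h.succ)) 0, rfl⟩, fun x => ?_, fun x => ?_⟩
    · simp [Fin.sum_univ_succ, Fin.tail]
    · rw [LinearMap.comp_apply, LinearMap.comp_apply, linearizedPoly_apply, Fin.sum_univ_succ]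
      simp [Fin.sum_univ_castSucc, Fin.tail, Function.iterate_succ_apply']

end Gabidulin

section FiniteField

variable {F L : Type*} [Field F] [Finite F] [Field L] [Algebra F L] [FiniteDimensional F L]

theorem exists_forall_apply_eq_pow (φ : L ≃ₐ[F] L) : ∃ e : ℕ, ∀ y, φ y = y ^ e := by
  have := Fintype.ofFinite F
  obtain ⟨i, -, rfl⟩ := exists_pow_eq_of_zpowers_eq_top
    (zpowers_frobeniusAlgEquivOfAlgebraic_pow_eq_top (Nat.coprime_one_left _)) φ
  exact ⟨_, fun y => by rw [← pow_mul, frobeniusAlgEquivOfAlgebraic_pow_apply]⟩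

theorem conj_algEquiv_smul {K : Type*} [Field K] [Algebra K L] {σ σ' : F →+* F}
    [RingHomInvPair σ σ'] [RingHomInvPair σ' σ] {A : L ≃ₛₗ[σ] L}
    (hA : ∀ κ : K, ∃ l, ∀ y, A (l * y) = κ • A y) {φ : L ≃ₐ[F] L} {κ κ' : K}
    (hφ : φ (algebraMap K L κ) = algebraMap K L κ') (y : L) :
    A.conj φ.toLinearMap (κ • y) = κ' • A.conj φ.toLinearMap y := by
  obtain ⟨e, he⟩ := exists_forall_apply_eq_pow φ
  have hκ : κ' = κ ^ e := (algebraMap K L).injective (by rw [← hφ, he, map_pow])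
  obtain ⟨l, hl⟩ := hA κ
  have hpow (i : ℕ) (z : L) : A (l ^ i * z) = κ ^ i • A z := by
    induction i with
    | zero => simp
    | succ i ih => rw [pow_succ', mul_assoc, hl, ih, smul_smul, pow_succ']
  obtain ⟨z, rfl⟩ := A.surjective y
  calc A (φ (A.symm (κ • A z))) = A (φ (l * z)) := by rw [← hl, A.symm_apply_apply]
    _ = κ ^ e • A (φ z) := by rw [map_mul φ, he l, hpow]
    _ = _ := by simp [hκ, LinearEquiv.conj_apply]

end FiniteField

section Core

theorem eq_one_of_forall_smul_mem {F K L : Type*} [Field F] [Field K] [Field L] [Algebra F K]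
    [Algebra K L] {τ ε : Gal(K/F)} {N : L →ₛₗ[(ε : K →+* K)] L} {t : ℕ}
    (hN : Function.Injective N) (ht0 : 0 < t) (ht : t < orderOf τ)
    (hC : ∀ (κ : K), ∀ v ∈ twistedCoeffs τ t N, κ • v ∈ twistedCoeffs τ t N) : ε = 1 := by
  classical
  have h1 := single_one_add_single_mem_twistedCoeffs ht0 ht N 1
  have hτt : τ ^ t ≠ 1 := pow_ne_one_of_lt_orderOf ht0.ne' ht
  have hN1 : N 1 ≠ 0 := (map_ne_zero_iff N hN).2 one_ne_zero
  ext κ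
  have h : κ • N 1 = ε κ • N 1 := by simpa [hτt, hτt.symm] using (hC κ _ h1).2
  exact (smul_left_injective K hN1 h).symm

variable {F K L : Type*} [Field F] [Finite F] [Field K] [Field L] [Algebra F K] [Algebra F L]
  [Algebra K L] [IsScalarTower F K L] [FiniteDimensional F K] [FiniteDimensional F L]
  {σ σ' : F →+* F} [RingHomInvPair σ σ'] [RingHomInvPair σ' σ]
  {φ : L ≃ₐ[F] L} {τ ε : Gal(K/F)} {N : L →ₛₗ[(ε : K →+* K)] L} {t t' : ℕ}
  {A : L ≃ₛₗ[σ] L} {γ : K →ₛₗ[σ'] L}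

theorem exists_map_mul_eq_smul (hτ : Subgroup.zpowers τ = ⊤) (hN : Function.Injective N)
    (ht0 : 0 < t) (ht : t + 2 ≤ orderOf τ) (hε : ε ≠ τ ^ t)
    (hC : ofGaloisCoeffs '' twistedCoeffs τ t N = gabidulinMaps φ t' A γ) (κ : K) :
    ∃ l, ∀ y, A (l * y) = κ • A y := by
  have : Finite K := Module.finite_of_finite F
  have : Finite L := Module.finite_of_finite F
  refine ⟨A.symm (κ • A 1), fun y => ?_⟩
  have h := map_smul_of_comp_mem hτ (Finite.surjective_of_injective hN) ht0 ht hε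
    (Θ := A.conj (mulLeft F y)) (hC ▸ fun f => conj_mulLeft_comp_mem_gabidulinMaps y) κ (A 1)
  simpa [LinearEquiv.conj_apply, mul_comm] using h

theorem exists_ofGaloisCoeffs_eq_map_mul {d : Gal(K/F)} {r₁ r₂ : ℕ}
    (hφ : ∀ κ, φ (algebraMap K L κ) = algebraMap K L (d κ))
    (hA : ∀ κ : K, ∃ l, ∀ y, A (l * y) = κ • A y)
    (hC : ofGaloisCoeffs '' twistedCoeffs τ t N = gabidulinMaps φ t' A γ)
    (ht : t < orderOf τ) (h₁ : r₁ < t) (h₂ : r₂ < t) (hr : r₁ ≠ r₂)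
    (hzero : ∀ ρ : L → L, ρ 0 = 0 → Function.Injective ρ →
      ∀ v ∈ twistedCoeffs τ t N, ∀ w ∈ twistedCoeffs τ t N, (∀ g, w (d * g) = ρ (v g)) →
        w (τ ^ r₁) = 0 ∧ w (τ ^ r₂) = 0) (p : L × L) :
    ∃ (l : L) (v : Gal(K/F) → L), (v (τ ^ r₁), v (τ ^ r₂)) = p ∧
      ∀ x, ofGaloisCoeffs v x = A (l * γ x) := by
  obtain ⟨v, hv, hv₁, hv₂⟩ := exists_mem_twistedCoeffs_apply_eq (N := N) h₁ h₂ hr ht p.1 p.2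
  obtain ⟨l, f, hf, g, hg, hl, hfg⟩ := exists_sub_eq_of_mem_gabidulinMaps (hC ▸ ⟨v, hv, rfl⟩ :
    ofGaloisCoeffs v ∈ gabidulinMaps φ t' A γ)
  obtain ⟨w, hw, rfl⟩ := hC.symm ▸ hf
  obtain ⟨u, hu, rfl⟩ := hC.symm ▸ hg
  let ρ : L →ₛₗ[(d : K →+* K)] L :=
    { A.conj φ.toLinearMap with map_smul' := fun κ => conj_algEquiv_smul hA (hφ κ) }
  have hρ : Function.Injective ρ := A.injective.comp (φ.injective.comp A.symm.injective)
  have hwu : w = fun g => ρ (u (d⁻¹ * g)) := ofGaloisCoeffs_injective <| LinearMap.ext fun x =>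
    (hfg x).trans (map_ofGaloisCoeffs ρ u x)
  obtain ⟨hw₁, hw₂⟩ := hzero ρ (map_zero ρ) hρ u hu w hw fun g => by simp [hwu]
  exact ⟨l, v - w, by simp [hw₁, hw₂, hv₁, hv₂], fun x => by rw [map_sub, hl]⟩

theorem image_twistedCoeffs_ne_gabidulinMaps (hτ : Subgroup.zpowers τ = ⊤)
    (hN : Function.Injective N) (ht0 : 0 < t) (ht : t + 2 ≤ orderOf τ) (hε : ε ≠ τ ^ t)
    (hε1 : ε = 1 → 2 ≤ t ∧ t + 3 ≤ orderOf τ) {d : Gal(K/F)} (hd : d ≠ 1)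
    (hφ : ∀ κ, φ (algebraMap K L κ) = algebraMap K L (d κ)) :
    ofGaloisCoeffs '' twistedCoeffs τ t N ≠ gabidulinMaps φ t' A γ := by
  intro hC
  have : Finite L := Module.finite_of_finite F
  have hA := exists_map_mul_eq_smul hτ hN ht0 ht hε hC
  have hsmul (κ : K) (v : Gal(K/F) → L) (hv : v ∈ twistedCoeffs τ t N) :
      κ • v ∈ twistedCoeffs τ t N := by
    obtain ⟨l, hl⟩ := hA κ
    obtain ⟨w, hw, hwv⟩ := hC ▸ conj_mulLeft_comp_mem_gabidulinMaps l (hC ▸ ⟨v, hv, rfl⟩ :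
      ofGaloisCoeffs v ∈ gabidulinMaps φ t' A γ)
    suffices w = κ • v from this ▸ hw
    refine ofGaloisCoeffs_injective (hwv.trans (LinearMap.ext fun x => ?_))
    rw [← algebraMap_smul L κ v, map_smul, LinearMap.smul_apply, algebraMap_smul]
    simp [LinearEquiv.conj_apply, hl]
  obtain ⟨ht2, ht3⟩ := hε1 (eq_one_of_forall_smul_mem hN ht0 (by lia) hsmul)
  obtain ⟨i, hi, rfl⟩ := exists_pow_eq_of_zpowers_eq_top hτ d
  have hi0 : 0 < i := Nat.pos_of_ne_zero fun h => hd (by rw [h, pow_zero])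
  obtain ⟨r₁, r₂, h₁, h₂, hr, hzero⟩ := exists_two_zeros (map_zero N) hN ht2 ht3 hi0 hi
  choose l v hv hlv using exists_ofGaloisCoeffs_eq_map_mul hφ hA hC (by lia) h₁ h₂ hr hzero
  have hl : Function.Injective l := fun p q hpq => by
    have hvv : v p = v q := ofGaloisCoeffs_injective <| LinearMap.ext fun x => by
      rw [hlv, hlv, hpq]
    rw [← hv p, ← hv q, hvv]
  have hcard := Nat.card_le_card_of_injective l hl
  rw [Nat.card_prod] at hcard
  have : 1 < Nat.card L := Finite.one_lt_card
  nlinarith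

end Core

/-! ### The punctured code -/

theorem sum_Ico_single_pow_apply {G M : Type*} [Group G] [DecidableEq G] [AddCommMonoid M] {τ : G}
    {t i : ℕ} (ht : t < orderOf τ) (c : ℕ → M) (hi : i < orderOf τ) :
    (∑ j ∈ Finset.Ico 1 t, Pi.single (τ ^ j) (c j) : G → M) (τ ^ i) =
      if i ∈ Finset.Ico 1 t then c i else 0 := by
  rw [Finset.sum_apply, ← Finset.sum_ite_eq]
  refine Finset.sum_congr rfl fun j hj => ?_
  have hj' : j < orderOf τ := (Finset.mem_Ico.1 hj).2.trans ht
  simp only [Pi.single_apply, pow_eq_pow_iff_of_lt_orderOf hi hj']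

theorem mem_twistedCoeffs_iff {G M : Type*} [Group G] [Finite G] [DecidableEq G] [AddCommMonoid M]
    {τ : G} {t : ℕ} {N : M → M} (hτ : Subgroup.zpowers τ = ⊤) (ht0 : 0 < t) (ht : t < orderOf τ)
    {v : G → M} :
    v ∈ twistedCoeffs τ t N ↔ ∃ (a : M) (c : ℕ → M),
      v = Pi.single 1 a + Pi.single (τ ^ t) (N a) +
        ∑ j ∈ Finset.Ico 1 t, Pi.single (τ ^ j) (c j) := by
  constructor
  · intro hv
    refine ⟨v 1, fun j => v (τ ^ j), funext fun g => ?_⟩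
    obtain ⟨i, hi, rfl⟩ := exists_pow_eq_of_zpowers_eq_top hτ g
    have hit : τ ^ i = τ ^ t ↔ i = t := pow_eq_pow_iff_of_lt_orderOf hi ht
    have hi1 : τ ^ i = 1 ↔ i = 0 := by
      rw [← pow_zero τ, pow_eq_pow_iff_of_lt_orderOf hi (by lia)]
    rw [Pi.add_apply, Pi.add_apply, sum_Ico_single_pow_apply ht _ hi]
    simp only [Pi.single_apply, hit, hi1, ← hv.2, Finset.mem_Ico]
    obtain rfl | h | rfl | h : i = 0 ∨ (1 ≤ i ∧ i < t) ∨ i = t ∨ t < i := by lia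
    · simp [ht0.ne]
    · simp [h, h.2.ne, Nat.ne_of_gt h.1]
    · simp [ht0.ne']
    · simp [hv.1 i h hi, h.ne', h.not_gt, (ht0.trans h).ne']
  · rintro ⟨a, c, rfl⟩
    have h := single_one_add_single_mem_twistedCoeffs ht0 ht N a
    refine ⟨fun i hti hi => ?_, ?_⟩
    · rw [Pi.add_apply, h.1 i hti hi, sum_Ico_single_pow_apply ht c hi, if_neg, add_zero]
      simp [hti.le]
    · have h0 := sum_Ico_single_pow_apply ht c (i := 0) (ht0.trans ht)
      rw [pow_zero] at h0
      rw [Pi.add_apply, Pi.add_apply _ _ (1 : G), sum_Ico_single_pow_apply ht c ht, h0, h.2]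
      simp

section PuncturedCode

variable {F L : Type*} [Field F] [Field L] [Algebra F L]

/-- The map `y ↦ c ψ(y)`, which is semilinear over the intermediate field `K` with respect to the
restriction of `ψ` to `K`. -/
def mulAlgEquiv (K : IntermediateField F L) [Normal F K] (c : L) (ψ : Gal(L/F)) :
    L →ₛₗ[(AlgEquiv.restrictNormalHom K ψ : K →+* K)] L where
  toFun y := c * ψ y
  map_add' := by simp [mul_add]
  map_smul' κ y := by
    have h : ψ (κ : L) = AlgEquiv.restrictNormalHom K ψ κ :=
      (AlgEquiv.restrictNormal_commutes ψ K κ).symm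
    simp only [IntermediateField.smul_def, smul_eq_mul, map_mul, h]
    exact mul_left_comm _ _ _

theorem mulAlgEquiv_injective (K : IntermediateField F L) [Normal F K] {c : L} (hc : c ≠ 0)
    (ψ : Gal(L/F)) : Function.Injective (mulAlgEquiv K c ψ) :=
  (mul_right_injective₀ hc).comp ψ.injective

theorem restrictNormalHom_ne_one_of_zpowers_eq_top [Normal F L] {K : IntermediateField F L}
    [FiniteDimensional F K] [IsGalois F K] (hK : 1 < finrank F K) {φ : Gal(L/F)}
    (hφ : Subgroup.zpowers φ = ⊤) : AlgEquiv.restrictNormalHom K φ ≠ 1 := by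
  intro h
  have hbot : (⊥ : Subgroup Gal(K/F)) = ⊤ := by
    rw [← Subgroup.zpowers_one_eq_bot, ← h, ← MonoidHom.map_zpowers, hφ,
      Subgroup.map_top_of_surjective _ (AlgEquiv.restrictNormalHom_surjective L)]
  rw [← IsGalois.card_aut_eq_finrank, ← Subgroup.card_top, ← hbot, Subgroup.card_bot] at hK
  exact hK.false

variable [Fintype F] [FiniteDimensional F L]

theorem traceForm_apply_eq_trace_mul (k : ℕ) (a : L) (j : ℕ) (x x' : L) :
    traceForm F k a j x x' = Algebra.trace F L
      (((FiniteField.frobeniusAlgEquivOfAlgebraic F L ^ k)⁻¹ ^ j) (a * x) * x') := by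
  set τ := (FiniteField.frobeniusAlgEquivOfAlgebraic F L ^ k)⁻¹ with hτ
  have hx' : (τ ^ j) (x' ^ Fintype.card F ^ (k * j)) = x' := by
    rw [← frobeniusAlgEquivOfAlgebraic_pow_apply, ← AlgEquiv.mul_apply, hτ, inv_pow, ← pow_mul,
      inv_mul_cancel, AlgEquiv.one_apply]
  calc traceForm F k a j x x'
      = Algebra.trace F L (a * x * x' ^ Fintype.card F ^ (k * j)) := rfl
    _ = Algebra.trace F L ((τ ^ j) (a * x * x' ^ Fintype.card F ^ (k * j))) :=
      (Algebra.trace_eq_of_algEquiv (τ ^ j) _).symm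
    _ = _ := by rw [map_mul (τ ^ j) (a * x), hx']

variable (K : IntermediateField F L) [Normal F K]

theorem restrictNormalHom_frobeniusAlgEquivOfAlgebraic :
    AlgEquiv.restrictNormalHom K (FiniteField.frobeniusAlgEquivOfAlgebraic F L) =
      FiniteField.frobeniusAlgEquivOfAlgebraic F K := by
  ext x
  refine (AlgEquiv.restrictNormal_commutes _ K x).trans ?_
  simp

theorem zpowers_restrictNormalHom_eq_top {k : ℕ} (hk : k.Coprime (finrank F K)) :
    Subgroup.zpowers (AlgEquiv.restrictNormalHom K
      (FiniteField.frobeniusAlgEquivOfAlgebraic F L ^ k)⁻¹) = ⊤ := by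
  rw [map_inv, Subgroup.zpowers_inv, map_pow, restrictNormalHom_frobeniusAlgEquivOfAlgebraic,
    zpowers_frobeniusAlgEquivOfAlgebraic_pow_eq_top hk]

theorem traceForm_comp_val [DecidableEq Gal(K/F)] (k : ℕ) (a : L) (j : ℕ)
    {τ : Gal(L/F)} (hτ : τ = (FiniteField.frobeniusAlgEquivOfAlgebraic F L ^ k)⁻¹) :
    traceForm F k a j ∘ₗ K.val.toLinearMap = (traceDual F L).congrRight
      (ofGaloisCoeffs (Pi.single (AlgEquiv.restrictNormalHom K τ ^ j) ((τ ^ j) a))) := by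
  ext x x'
  have hx : ((AlgEquiv.restrictNormalHom K τ ^ j) x : L) = (τ ^ j) x := by
    rw [← map_pow]
    exact AlgEquiv.restrictNormal_commutes _ K x
  calc traceForm F k a j x x' = Algebra.trace F L ((τ ^ j) (a * x) * x') := by
        rw [traceForm_apply_eq_trace_mul, hτ]
    _ = traceDual F L (ofGaloisCoeffs
          (Pi.single (AlgEquiv.restrictNormalHom K τ ^ j) ((τ ^ j) a)) x) x' := by
      rw [ofGaloisCoeffs_single, traceDual_apply, IntermediateField.smul_def, hx, smul_eq_mul,
        map_mul (τ ^ j), mul_comm ((τ ^ j) a)]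

theorem puncturedTwistedGabidulin_eq {τ : Gal(L/F)} {k t : ℕ}
    (hτk : τ = (FiniteField.frobeniusAlgEquivOfAlgebraic F L ^ k)⁻¹)
    (hτ : Subgroup.zpowers (AlgEquiv.restrictNormalHom K τ) = ⊤) (ht0 : 0 < t)
    (ht : t < orderOf (AlgEquiv.restrictNormalHom K τ)) (μ : L) (s : ℤ) :
    puncturedTwistedGabidulin F K t μ s k = (traceDual F L).congrRight ''
      (ofGaloisCoeffs '' twistedCoeffs (AlgEquiv.restrictNormalHom K τ) t
        (mulAlgEquiv K ((τ ^ t) μ) (τ ^ ((t : ℤ) - s)))) := by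
  classical
  set τK := AlgEquiv.restrictNormalHom K τ
  set N := mulAlgEquiv K ((τ ^ t) μ) (τ ^ ((t : ℤ) - s))
  have hN (a : L) :
      (τ ^ t) (μ * (FiniteField.frobeniusAlgEquivOfAlgebraic F L ^ (s * k)) a) = N a := by
    have hpow : FiniteField.frobeniusAlgEquivOfAlgebraic F L ^ (s * k) = τ ^ (-s) := by
      rw [hτk, inv_zpow', neg_neg, mul_comm, zpow_mul, zpow_natCast]
    rw [hpow, map_mul, ← AlgEquiv.mul_apply, ← zpow_natCast τ t, ← zpow_add, ← sub_eq_add_neg]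
    simp [N, mulAlgEquiv]
  have hform (a : L) (c : ℕ → L) :
      (traceForm F k a 0 + traceForm F k
        (μ * (FiniteField.frobeniusAlgEquivOfAlgebraic F L ^ (s * (k : ℤ))) a) t +
        ∑ j ∈ Finset.Ico 1 t, traceForm F k (c j) j) ∘ₗ K.val.toLinearMap =
      (traceDual F L).congrRight (ofGaloisCoeffs (Pi.single 1 a + Pi.single (τK ^ t) (N a) +
        ∑ j ∈ Finset.Ico 1 t, Pi.single (τK ^ j) ((τ ^ j) (c j)))) := by
    rw [← lcomp_apply' (S := F)]
    have hval (a : L) (j : ℕ) := traceForm_comp_val K k a j hτk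
    simp only [← lcomp_apply' (S := F)] at hval
    simp only [map_add, map_sum, hval, hN, pow_zero, AlgEquiv.one_apply, τK]
  refine Set.Subset.antisymm ?_ ?_
  · rintro _ ⟨_, ⟨a, c, rfl⟩, rfl⟩
    exact ⟨_, ⟨_, (mem_twistedCoeffs_iff hτ ht0 ht).2 ⟨a, _, rfl⟩, rfl⟩, (hform a c).symm⟩
  · rintro _ ⟨_, ⟨v, hv, rfl⟩, rfl⟩
    obtain ⟨a, c, rfl⟩ := (mem_twistedCoeffs_iff hτ ht0 ht).1 hv
    refine ⟨_, ⟨a, fun j => (τ ^ j).symm (c j), rfl⟩, (hform _ _).trans ?_⟩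
    simp only [AlgEquiv.apply_symm_apply]

end PuncturedCode

end RankMetric

open RankMetric in
theorem mainTheorem1_general {F L : Type*} [Field F] [Fintype F] [Field L] [Algebra F L]
    [FiniteDimensional F L] (K : IntermediateField F L) (m : ℕ) (hK : Module.finrank F K = m)
    (k : ℕ) (hkm : Nat.Coprime k m) (t : ℕ) (ht1 : 1 ≤ t) (ht2 : t + 2 ≤ m) (μ : L) (hμ0 : μ ≠ 0)
    (s : ℤ) (hs0 : ¬ s ≡ 0 [ZMOD m]) (hst : s ≡ t [ZMOD m] → 2 ≤ t ∧ t + 3 ≤ m)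
    (G : Set (K →ₗ[F] L →ₗ[F] F)) (hG : IsGeneralizedGabidulin F L G) :
    ¬ CodeEquivalent (puncturedTwistedGabidulin F K t μ s k) G := by
  intro hPG
  subst hK
  have : Finite K := Module.finite_of_finite F
  have : Finite L := Module.finite_of_finite F
  obtain ⟨φ, hφ, _, _, _, _, _, A, γ, hP⟩ :=
    exists_eq_gabidulinMaps_of_codeEquivalent (V := K) K.toSubmodule.finrank_le hG hPG
  set τ := (FiniteField.frobeniusAlgEquivOfAlgebraic F L ^ k)⁻¹ with hτk
  set τK := AlgEquiv.restrictNormalHom K τ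
  have hτ : Subgroup.zpowers τK = ⊤ := zpowers_restrictNormalHom_eq_top K hkm
  have hm : orderOf τK = Module.finrank F K := by
    rw [orderOf_eq_card_of_zpowers_eq_top hτ, IsGalois.card_aut_eq_finrank]
  have hε : AlgEquiv.restrictNormalHom K (τ ^ ((t : ℤ) - s)) = τK ^ ((t : ℤ) - s) := map_zpow _ _ _
  rw [puncturedTwistedGabidulin_eq K hτk hτ ht1 (by lia)] at hP
  refine image_twistedCoeffs_ne_gabidulinMaps hτ
    (mulAlgEquiv_injective K ((map_ne_zero (τ ^ t)).2 hμ0) _) ht1 (by lia) (fun h => hs0 ?_)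
    (fun h => ?_) (restrictNormalHom_ne_one_of_zpowers_eq_top (by lia) hφ)
    (fun κ => (AlgEquiv.restrictNormal_commutes φ K κ).symm)
    (eq_gabidulinMaps_of_image_congrRight_eq _ hP)
  · rw [hε, ← zpow_natCast, zpow_eq_zpow_iff_modEq, hm] at h
    simpa using (Int.ModEq.refl (t : ℤ)).sub h
  · rw [hε, ← zpow_zero τK, zpow_eq_zpow_iff_modEq, hm] at h
    rw [hm]
    exact hst (by simpa using (Int.ModEq.refl s).add h.symm)

theorem mainTheorem1 {F L : Type*} [Field F] [Fintype F] [Field L] [Algebra F L]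
    [FiniteDimensional F L] (K : IntermediateField F L)
    (m n : ℕ) (hm : 1 < m) (hmn : m ∣ n)
    (hK : Module.finrank F K = m) (hL : Module.finrank F L = n)
    (k : ℕ) (hk : 1 ≤ k) (hkn : Nat.Coprime k n)
    (t : ℕ) (ht1 : 1 ≤ t) (ht2 : t + 2 ≤ m)
    (μ : L) (hμ0 : μ ≠ 0) (hμ : Algebra.norm F μ ≠ (-1) ^ (n * t))
    (s : ℤ)
    (hs : ¬ s ≡ 0 [ZMOD m] ∧ ¬ s ≡ 1 [ZMOD m] ∧ ¬ s ≡ -1 [ZMOD m] ∧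
      ¬ s ≡ 2 [ZMOD m] ∧ ¬ s ≡ -2 [ZMOD m])
    (hgcd : Int.gcd n (s * k - t) < m)
    (G : Set (K →ₗ[F] L →ₗ[F] F)) (hG : RankMetric.IsGeneralizedGabidulin F L G) :
    ¬ RankMetric.CodeEquivalent (RankMetric.puncturedTwistedGabidulin F K t μ s k) G := by
  obtain ⟨hs0, hs1, -, -, hs2⟩ := hs
  refine mainTheorem1_general K m hK k (hkn.coprime_dvd_right hmn) t ht1 ht2 μ hμ0 s hs0
    (fun hst => ⟨?_, ?_⟩) G hG
  · by_contra h
    obtain rfl : t = 1 := by lia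
    exact hs1 (by simpa using hst)
  · by_contra h
    obtain rfl : m = t + 2 := by lia
    exact hs2 (hst.trans (Int.modEq_iff_dvd.2 ⟨-1, by push_cast; ring⟩))
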